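/- Let $1\le k\le\min\{n_1,n_2\}$, let $\tau=(k_1,\dots,k_t)$ be integers $k_i\ge1$ with $k_1+\dots+k_t=k$, and let $B_1,\dots,B_N\in\mathbb C^{n_1\times n_2}$. For $A\in\mathbb C^{k\times k}$, partitioned into blocks $A_{pq}\in\mathbb C^{k_p\times k_q}$, let $\mathrm{BDiag}_\tau(A)=\mathrm{diag}(A_{11},\dots,A_{tt})$, and let $\mathrm{St}(k,n)=\{P\in\mathbb C^{n\times k}: P^{H}P=I_k\}$. For $U\in\mathbb C^{n_1\times k}$, $V\in\mathbb C^{n_2\times k}$ put $$f(U,V)=\sum_{\ell=1}^N\|\mathrm{BDiag}_\tau(U^{H}B_\ell V)\|_F^2,$$ and let $\mathscr H_1=\nabla_Uf$, $\mathscr H_2=\nabla_Vf$ be the partial Euclidean gradients with respect to $\langle X,Y\rangle=\mathrm{Re}\,\mathrm{tr}(Y^{H}X)$, i.e. $$\mathscr H_1(U,V)=2\sum_\ell B_\ell V\,\mathrm{BDiag}_\tau(V^{H}B_\ell^{H}U),\qquad \mathscr H_2(U,V)=2\sum_\ell B_\ell^{H}U\,\mathrm{BDiag}_\tau(U^{H}B_\ell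 V).$$ Let $\|\cdot\|_{\mathrm{tr}}$ be the trace (nuclear) norm, $\sigma_{\min}(X)$ the smallest of the $\min\{m,n\}$ singular values of $X\in\mathbb C^{m\times n}$, $\mathcal R(X)$ the column space of $X$, $\mathrm{sym}(X)=(X+X^{H})/2$, and $\Theta(\cdot,\cdot)$ the diagonal matrix of the canonical angles between two subspaces. An orthonormal polar factor of $A\in\mathbb C^{n\times k}$ is any $Q\in\mathrm{St}(k,n)$ with $A=Q\Lambda$ for some $\Lambda\succeq0$. Basic iteration (Gauss–Seidel type): from an initial pair $(U^{(0)},V^{(0)})$ with orthonormal columns, $U^{(i+1)}$ is an orthonormal polar factor of $\mathscr H_1(U^{(i)},V^{(i)})$, and then $V^{(i+1)}$ is an orthonormal polar factor of $\mathscr H_2(U^{(i+1)},V^{(i)})$. LOCG-accelerated iteration: let $(U^{(0)},V^{(0)})\in\mathrm{St}(k,n_1)\times\mathrm{St}(k,n_2)$. For $j=0,1,2,\dots$ write $\mathscr H_i^{(j)}=\mathscr H_i(U^{(j)},V^{(j)})$ and let $$R_1^{(j)}=\mathscr H_1^{(j)}-U^{(j)}\mathrm{sym}\big([U^{(j)}]^{H}\mathscr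 H_1^{(j)}\big),\qquad R_2^{(j)}=\mathscr H_2^{(j)}-V^{(j)}\mathrm{sym}\big([V^{(j)}]^{H}\mathscr H_2^{(j)}\big).$$ Choose $S_i\in\mathrm{St}(\hat n_i,n_i)$ with $\mathcal R(S_1)=\mathcal R([U^{(j)},R_1^{(j)},U^{(j-1)}])$ and $\mathcal R(S_2)=\mathcal R([V^{(j)},R_2^{(j)},V^{(j-1)}])$ (the last blocks being absent for $j=0$), whose first $k$ columns are $U^{(j)}$ and $V^{(j)}$, respectively. Apply the basic Gauss–Seidel iteration to the reduced matrices $S_1^{H}B_\ell S_2$, starting from the first $k$ columns of $I_{\hat n_1}$ and $I_{\hat n_2}$; let $(Z_1,Z_2)$ be its output (an iterate at which it is stopped, or a limit of a convergent subsequence of its iterates), and set $U^{(j+1)}=S_1Z_1$, $V^{(j+1)}=S_2Z_2$. Let $\{(U^{(j)},V^{(j)})\}_{j\ge0}$ be generated in this way, and suppose that there is a constant $c>0$, independent of $j$, such that for all $j\ge0$ $$f(U^{(j+1)},V^{(j+1)})-f(U^{(j)},V^{(j)})\ge c\max\Big\{\|\mathscr H_1^{(j)}\|_{\mathrm{tr}}-\mathrm{tr}\big([U^{(j)}]^{H}\mathscr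 H_1^{(j)}\big),\ \|\mathscr H_2^{(j)}\|_{\mathrm{tr}}-\mathrm{tr}\big([V^{(j)}]^{H}\mathscr H_2^{(j)}\big)\Big\}.$$ Then: (a) The sequence $\{f(U^{(j)},V^{(j)})\}_{j\ge0}$ is monotonically increasing (non-decreasing) and convergent. (b) If $(U_*,V_*)$ is an accumulation point of $\{(U^{(j)},V^{(j)})\}$, i.e. the limit of a subsequence, then $U_*\in\mathrm{St}(k,n_1)$, $V_*\in\mathrm{St}(k,n_2)$ and $$\mathscr H_1(U_*,V_*)=U_*\Lambda_{1*},\quad \Lambda_{1*}=U_*^{H}\mathscr H_1(U_*,V_*)\succeq0,\qquad \mathscr H_2(U_*,V_*)=V_*\Lambda_{2*},\quad \Lambda_{2*}=V_*^{H}\mathscr H_2(U_*,V_*)\succeq0.$$ (c) The following four series converge (a term with $\sigma_{\min}(\mathscr H_i^{(j)})=0$ is read as $0$): $$\sum_{j=0}^\infty\sigma_{\min}(\mathscr H_1^{(j)})\,\big\|\sin\Theta\big(\mathcal R(\mathscr H_1^{(j)}),\mathcal R(U^{(j)})\big)\big\|_F^2<\infty,\qquad \sum_{j=0}^\infty\sigma_{\min}(\mathscr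 H_2^{(j)})\,\big\|\sin\Theta\big(\mathcal R(\mathscr H_2^{(j)}),\mathcal R(V^{(j)})\big)\big\|_F^2<\infty,$$ $$\sum_{j=0}^\infty\sigma_{\min}(\mathscr H_1^{(j)})\,\frac{\big\|\mathscr H_1^{(j)}-U^{(j)}\big([U^{(j)}]^{H}\mathscr H_1^{(j)}\big)\big\|_F^2}{\|\mathscr H_1^{(j)}\|_F^2}<\infty,\qquad \sum_{j=0}^\infty\sigma_{\min}(\mathscr H_2^{(j)})\,\frac{\big\|\mathscr H_2^{(j)}-V^{(j)}\big([V^{(j)}]^{H}\mathscr H_2^{(j)}\big)\big\|_F^2}{\|\mathscr H_2^{(j)}\|_F^2}<\infty.$$ -/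

import Mathlib

namespace PJBSVD

noncomputable section

open scoped Matrix ComplexOrder
open Filter Topology

section Norms

attribute [local instance] Matrix.frobeniusNormedAddCommGroup

/-- The Frobenius norm of a matrix. -/
def frobNorm {𝕜 : Type*} [RCLike 𝕜] {m n : Type*} [Fintype m] [Fintype n]
    (A : Matrix m n 𝕜) : ℝ := ‖A‖

end Norms

/-- The `i`-th largest singular value of `A` (indices start at `0`). An `m × n` matrix has
`min m n` singular values, those with index `i < min m n`. -/
def singVal {m n : ℕ} (A : Matrix (Fin m) (Fin n) ℂ) (i : ℕ) : ℝ :=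
  (Matrix.toEuclideanLin A).singularValues i

/-- The trace norm (nuclear norm): the sum of the singular values. -/
def traceNorm {m n : ℕ} (A : Matrix (Fin m) (Fin n) ℂ) : ℝ :=
  ∑ i ∈ Finset.range (min m n), singVal A i

/-- The smallest singular value, i.e. the last of the `min m n` singular values. -/
def sigmaMin {m n : ℕ} (A : Matrix (Fin m) (Fin n) ℂ) : ℝ :=
  singVal A (min m n - 1)

/-- The column space of a matrix, as a subspace of the Euclidean space `ℂⁿ`. -/
def colSpace {n : ℕ} {κ : Type*} [Fintype κ] [DecidableEq κ] (A : Matrix (Fin n) κ ℂ) :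
    Submodule ℂ (EuclideanSpace ℂ (Fin n)) :=
  LinearMap.range (Matrix.toEuclideanLin A)

/-- The `i`-th canonical angle between two subspaces. The cosines of the canonical angles are the
singular values of the orthogonal projection onto `Y` restricted to `X`, whose matrix is `Qᴴ P`
whenever the columns of `P` and `Q` are orthonormal bases of `X` and `Y`. -/
def canonicalAngle {n : ℕ} (X Y : Submodule ℂ (EuclideanSpace ℂ (Fin n))) (i : ℕ) : ℝ :=
  Real.arccos (LinearMap.singularValues (𝕜 := ℂ) (E := X) (F := Y)
    (Y.orthogonalProjectionOnto.toLinearMap ∘ₗ X.subtype) i)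

/-- The diagonal matrix `sin Θ(X, Y)` of the sines of the canonical angles. -/
def sinTheta {n : ℕ} (X Y : Submodule ℂ (EuclideanSpace ℂ (Fin n))) :
    Matrix (Fin (min (Module.finrank ℂ X) (Module.finrank ℂ Y)))
      (Fin (min (Module.finrank ℂ X) (Module.finrank ℂ Y))) ℝ :=
  Matrix.diagonal fun i => Real.sin (canonicalAngle X Y i)

/-- The complex Stiefel manifold of `n × k` matrices with orthonormal columns. -/
def stiefel (n k : ℕ) : Set (Matrix (Fin n) (Fin k) ℂ) := {P | Pᴴ * P = 1}

/-- The `τ`-block diagonal part of a `k × k` matrix, for `τ = (k₁, …, k_t)` with `k₁ + ⋯ + k_t = k`;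
`τ.index i` is the number of the block that contains the index `i`. -/
def blockDiagPart {k : ℕ} (τ : Composition k) (A : Matrix (Fin k) (Fin k) ℂ) :
    Matrix (Fin k) (Fin k) ℂ :=
  Matrix.of fun i j => if τ.index i = τ.index j then A i j else 0

section Problem

variable {k n₁ n₂ N : ℕ}

/-- The objective `f(U, V) = ∑ ℓ, ‖BDiag_τ(Uᴴ B_ℓ V)‖_F²`. -/
def objective (τ : Composition k) (B : Fin N → Matrix (Fin n₁) (Fin n₂) ℂ)
    (U : Matrix (Fin n₁) (Fin k) ℂ) (V : Matrix (Fin n₂) (Fin k) ℂ) : ℝ :=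
  ∑ l, frobNorm (blockDiagPart τ (Uᴴ * B l * V)) ^ 2

/-- The partial Euclidean gradient of the objective in `U`: its `i`-th block column is
`2 ∑ ℓ, B_ℓ V_i (V_iᴴ B_ℓᴴ U_i)`. -/
def gradU (τ : Composition k) (B : Fin N → Matrix (Fin n₁) (Fin n₂) ℂ)
    (U : Matrix (Fin n₁) (Fin k) ℂ) (V : Matrix (Fin n₂) (Fin k) ℂ) :
    Matrix (Fin n₁) (Fin k) ℂ :=
  (2 : ℂ) • ∑ l, B l * V * blockDiagPart τ (Vᴴ * (B l)ᴴ * U)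

/-- The partial Euclidean gradient of the objective in `V`: its `i`-th block column is
`2 ∑ ℓ, B_ℓᴴ U_i (U_iᴴ B_ℓ V_i)`. -/
def gradV (τ : Composition k) (B : Fin N → Matrix (Fin n₁) (Fin n₂) ℂ)
    (U : Matrix (Fin n₁) (Fin k) ℂ) (V : Matrix (Fin n₂) (Fin k) ℂ) :
    Matrix (Fin n₂) (Fin k) ℂ :=
  (2 : ℂ) • ∑ l, (B l)ᴴ * U * blockDiagPart τ (Uᴴ * B l * V)

/-- `G` is the Euclidean gradient of the real-valued function `g` at `P`, for the inner product
`⟨X, Y⟩ = Re tr(Yᴴ X)`. -/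
def IsEuclideanGradient {n : ℕ} (g : Matrix (Fin n) (Fin k) ℂ → ℝ)
    (P G : Matrix (Fin n) (Fin k) ℂ) : Prop :=
  (fun E : Matrix (Fin n) (Fin k) ℂ => g (P + E) - g P - (Matrix.trace (Eᴴ * G)).re)
    =o[𝓝 0] fun E => frobNorm E

section GradientFacts

attribute [local instance] Matrix.frobeniusNormedAddCommGroup

theorem frobNorm_sq {m n : Type*} [Fintype m] [Fintype n] (A : Matrix m n ℂ) :
    frobNorm A ^ 2 = ∑ i, ∑ j, ‖A i j‖ ^ 2 := by
  have h : (0 : ℝ) ≤ ∑ i, ∑ j, ‖A i j‖ ^ 2 := by positivity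
  rw [frobNorm, Matrix.frobenius_norm_def, ← Real.sqrt_eq_rpow]
  simp only [Real.rpow_two]
  exact Real.sq_sqrt h

theorem frobNorm_blockDiagPart_le (τ : Composition k) (A : Matrix (Fin k) (Fin k) ℂ) :
    frobNorm (blockDiagPart τ A) ^ 2 ≤ frobNorm A ^ 2 := by
  rw [frobNorm_sq, frobNorm_sq]
  refine Finset.sum_le_sum fun i _ => Finset.sum_le_sum fun j _ => ?_
  by_cases h : τ.index i = τ.index j <;> simp [blockDiagPart, h]

theorem frobNorm_blockDiagPart_add (τ : Composition k) (X Y : Matrix (Fin k) (Fin k) ℂ) :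
    frobNorm (blockDiagPart τ (X + Y)) ^ 2 = frobNorm (blockDiagPart τ X) ^ 2 +
      2 * (Matrix.trace (Y * blockDiagPart τ Xᴴ)).re + frobNorm (blockDiagPart τ Y) ^ 2 := by
  simp only [frobNorm_sq, Matrix.trace, Matrix.diag, Matrix.mul_apply, Complex.re_sum,
    Finset.mul_sum, ← Finset.sum_add_distrib]
  refine Finset.sum_congr rfl fun i _ => Finset.sum_congr rfl fun j _ => ?_
  by_cases h : τ.index i = τ.index j
  · simp only [blockDiagPart, Matrix.of_apply, h, if_true, Matrix.add_apply,
      Matrix.conjTranspose_apply, ← Complex.normSq_eq_norm_sq, Complex.normSq_apply]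
    simp
    ring
  · simp [blockDiagPart, h, Ne.symm h]

theorem objective_add_left (τ : Composition k) (B : Fin N → Matrix (Fin n₁) (Fin n₂) ℂ)
    (U E : Matrix (Fin n₁) (Fin k) ℂ) (V : Matrix (Fin n₂) (Fin k) ℂ) :
    objective τ B (U + E) V = objective τ B U V + (Matrix.trace (Eᴴ * gradU τ B U V)).re +
      objective τ B E V := by
  simp only [objective, gradU, Matrix.mul_smul, Matrix.mul_sum, Matrix.trace_smul,
    Matrix.trace_sum, smul_eq_mul, Finset.mul_sum, Complex.re_sum, ← Finset.sum_add_distrib]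
  refine Finset.sum_congr rfl fun l _ => ?_
  rw [Matrix.conjTranspose_add, Matrix.add_mul, Matrix.add_mul, frobNorm_blockDiagPart_add]
  simp [Matrix.mul_assoc]

theorem objective_swap (τ : Composition k) (B : Fin N → Matrix (Fin n₁) (Fin n₂) ℂ)
    (U : Matrix (Fin n₁) (Fin k) ℂ) (V : Matrix (Fin n₂) (Fin k) ℂ) :
    objective τ (fun l => (B l)ᴴ) V U = objective τ B U V := by
  refine Finset.sum_congr rfl fun l _ => ?_
  rw [frobNorm_sq, frobNorm_sq, Finset.sum_comm]
  refine Finset.sum_congr rfl fun i _ => Finset.sum_congr rfl fun j _ => ?_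
  have h : Vᴴ * (B l)ᴴ * U = (Uᴴ * B l * V)ᴴ := by simp [Matrix.mul_assoc]
  by_cases h' : τ.index i = τ.index j
  · simp [blockDiagPart, h, h']
  · simp [blockDiagPart, h', Ne.symm h']

theorem gradU_isEuclideanGradient (τ : Composition k)
    (B : Fin N → Matrix (Fin n₁) (Fin n₂) ℂ)
    (U : Matrix (Fin n₁) (Fin k) ℂ) (V : Matrix (Fin n₂) (Fin k) ℂ) :
    IsEuclideanGradient (fun X => objective τ B X V) U (gradU τ B U V) := by
  have hO : (fun E : Matrix (Fin n₁) (Fin k) ℂ => objective τ B E V)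
      =O[𝓝 0] fun E : Matrix (Fin n₁) (Fin k) ℂ => ‖E‖ ^ 2 := by
    refine Asymptotics.IsBigO.of_bound (∑ l, ‖B l * V‖ ^ 2) (Eventually.of_forall fun E => ?_)
    have h0 : 0 ≤ objective τ B E V := Finset.sum_nonneg fun l _ => sq_nonneg _
    rw [Real.norm_of_nonneg h0, Real.norm_of_nonneg (sq_nonneg _), Finset.sum_mul]
    refine Finset.sum_le_sum fun l _ => (frobNorm_blockDiagPart_le τ _).trans ?_
    rw [← mul_pow, Matrix.mul_assoc]
    have h1 := Matrix.frobenius_norm_mul Eᴴ (B l * V)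
    rw [Matrix.frobenius_norm_conjTranspose, mul_comm] at h1
    exact pow_le_pow_left₀ (norm_nonneg _) h1 2
  have ho : (fun E : Matrix (Fin n₁) (Fin k) ℂ => ‖E‖ ^ 2) =o[𝓝 0]
      fun E : Matrix (Fin n₁) (Fin k) ℂ => frobNorm E := by
    have := Asymptotics.isLittleO_norm_pow_id (E' := Matrix (Fin n₁) (Fin k) ℂ) one_lt_two
    exact this.norm_right
  refine (hO.trans_isLittleO ho).congr_left fun E => ?_
  simp only [objective_add_left]
  ring

theorem gradV_isEuclideanGradient (τ : Composition k)
    (B : Fin N → Matrix (Fin n₁) (Fin n₂) ℂ)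
    (U : Matrix (Fin n₁) (Fin k) ℂ) (V : Matrix (Fin n₂) (Fin k) ℂ) :
    IsEuclideanGradient (fun Y => objective τ B U Y) V (gradV τ B U V) := by
  have h := gradU_isEuclideanGradient τ (fun l => (B l)ᴴ) V U
  simpa only [objective_swap, gradU, gradV, Matrix.conjTranspose_conjTranspose] using h

end GradientFacts

/-- The gap `‖H‖_tr - tr(Pᴴ H)`. For `P = U` and `H = gradU τ B U V`, or `P = V` and
`H = gradV τ B U V`, the trace is real. -/
def polarGap {n : ℕ} (P H : Matrix (Fin n) (Fin k) ℂ) : ℝ :=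
  traceNorm H - (Matrix.trace (Pᴴ * H)).re

/-- `Q` is an orthonormal polar factor of `A`: it has orthonormal columns and `A = Q Λ` with `Λ`
Hermitian positive semidefinite. -/
def IsPolarFactor {n : ℕ} (A Q : Matrix (Fin n) (Fin k) ℂ) : Prop :=
  Q ∈ stiefel n k ∧ ∃ L : Matrix (Fin k) (Fin k) ℂ, L.PosSemidef ∧ A = Q * L

/-- The KKT conditions in polar form: `H = P Λ` with `Λ = Pᴴ H ⪰ 0` for both partial gradients. -/
def PolarKKT (τ : Composition k) (B : Fin N → Matrix (Fin n₁) (Fin n₂) ℂ)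
    (U : Matrix (Fin n₁) (Fin k) ℂ) (V : Matrix (Fin n₂) (Fin k) ℂ) : Prop :=
  (U ∈ stiefel n₁ k ∧ gradU τ B U V = U * (Uᴴ * gradU τ B U V) ∧
    (Uᴴ * gradU τ B U V).PosSemidef) ∧
  (V ∈ stiefel n₂ k ∧ gradV τ B U V = V * (Vᴴ * gradV τ B U V) ∧
    (Vᴴ * gradV τ B U V).PosSemidef)

/-- The residual `H - P sym(Pᴴ H)`, where `sym(X) = (X + Xᴴ) / 2`. -/
def residual {n : ℕ} (P H : Matrix (Fin n) (Fin k) ℂ) : Matrix (Fin n) (Fin k) ℂ :=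
  H - P * ((1 / 2 : ℂ) • (Pᴴ * H + (Pᴴ * H)ᴴ))

/-- The sequence `(U j, V j)` is generated by the (unaccelerated) alternating NPDo iteration with
Gauss-Seidel-type updating for the matrices `B` from the initial pair `(U₀, V₀)`. -/
def IsNPDoGaussSeidel (τ : Composition k) (B : Fin N → Matrix (Fin n₁) (Fin n₂) ℂ)
    (U₀ : Matrix (Fin n₁) (Fin k) ℂ) (V₀ : Matrix (Fin n₂) (Fin k) ℂ)
    (U : ℕ → Matrix (Fin n₁) (Fin k) ℂ) (V : ℕ → Matrix (Fin n₂) (Fin k) ℂ) : Prop :=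
  U 0 = U₀ ∧ V 0 = V₀ ∧ U₀ ∈ stiefel n₁ k ∧ V₀ ∈ stiefel n₂ k ∧
  ∀ j, IsPolarFactor (gradU τ B (U j) (V j)) (U (j + 1)) ∧
    IsPolarFactor (gradV τ B (U (j + 1)) (V j)) (V (j + 1))

/-- `(Z₁, Z₂)` is an output of the alternating NPDo iteration with Gauss-Seidel-type updating for
`B` from `(U₀, V₀)`: an iterate at which the iteration is stopped or, if the iteration is carried
out to full convergence, a limit of (a subsequence of) its iterates. -/
def IsNPDoOutput (τ : Composition k) (B : Fin N → Matrix (Fin n₁) (Fin n₂) ℂ)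
    (U₀ : Matrix (Fin n₁) (Fin k) ℂ) (V₀ : Matrix (Fin n₂) (Fin k) ℂ)
    (Z₁ : Matrix (Fin n₁) (Fin k) ℂ) (Z₂ : Matrix (Fin n₂) (Fin k) ℂ) : Prop :=
  ∃ (U : ℕ → Matrix (Fin n₁) (Fin k) ℂ) (V : ℕ → Matrix (Fin n₂) (Fin k) ℂ),
    IsNPDoGaussSeidel τ B U₀ V₀ U V ∧
    ((∃ m, Z₁ = U m ∧ Z₂ = V m) ∨
      ∃ φ : ℕ → ℕ, StrictMono φ ∧ Tendsto (fun i => (U (φ i), V (φ i))) atTop (𝓝 (Z₁, Z₂)))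

/-- The search subspace of the LOCG acceleration at step `j`: the column space of
`[P⁽ʲ⁾, R⁽ʲ⁾, P⁽ʲ⁻¹⁾]`, where the last block is absent for `j = 0`. -/
def searchSpace {n : ℕ} (P R : ℕ → Matrix (Fin n) (Fin k) ℂ) :
    ℕ → Submodule ℂ (EuclideanSpace ℂ (Fin n))
  | 0 => colSpace (Matrix.fromCols (P 0) (R 0))
  | j + 1 => colSpace (Matrix.fromCols (Matrix.fromCols (P (j + 1)) (R (j + 1))) (P j))

/-- `S` is an orthonormal basis matrix of the subspace `W` (with `k + p` columns), the first `k`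
columns of which are `P`. -/
def IsExtendedBasis {n p : ℕ} (W : Submodule ℂ (EuclideanSpace ℂ (Fin n)))
    (P : Matrix (Fin n) (Fin k) ℂ) (S : Matrix (Fin n) (Fin (k + p)) ℂ) : Prop :=
  S ∈ stiefel n (k + p) ∧ colSpace S = W ∧ S.submatrix id (Fin.castAdd p) = P

/-- The first `k` columns of the identity matrix of order `k + p`. -/
def firstCols (k p : ℕ) : Matrix (Fin (k + p)) (Fin k) ℂ :=
  (1 : Matrix (Fin (k + p)) (Fin (k + p)) ℂ).submatrix id (Fin.castAdd p)

/-- The sequence `(U j, V j)` is generated by the LOCG-accelerated NPDo iteration in which the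
reduced problems, for the matrices `S₁ᴴ B_ℓ S₂`, are treated by the alternating NPDo iteration with
Gauss-Seidel-type updating. -/
def IsAccNPDoGaussSeidel (τ : Composition k) (B : Fin N → Matrix (Fin n₁) (Fin n₂) ℂ)
    (U : ℕ → Matrix (Fin n₁) (Fin k) ℂ) (V : ℕ → Matrix (Fin n₂) (Fin k) ℂ) : Prop :=
  U 0 ∈ stiefel n₁ k ∧ V 0 ∈ stiefel n₂ k ∧
  ∀ j, ∃ (p₁ p₂ : ℕ) (S₁ : Matrix (Fin n₁) (Fin (k + p₁)) ℂ)
    (S₂ : Matrix (Fin n₂) (Fin (k + p₂)) ℂ)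
    (Z₁ : Matrix (Fin (k + p₁)) (Fin k) ℂ) (Z₂ : Matrix (Fin (k + p₂)) (Fin k) ℂ),
    IsExtendedBasis (searchSpace U (fun i => residual (U i) (gradU τ B (U i) (V i))) j) (U j) S₁ ∧
    IsExtendedBasis (searchSpace V (fun i => residual (V i) (gradV τ B (U i) (V i))) j) (V j) S₂ ∧
    IsNPDoOutput τ (fun l => S₁ᴴ * B l * S₂) (firstCols k p₁) (firstCols k p₂) Z₁ Z₂ ∧
    U (j + 1) = S₁ * Z₁ ∧ V (j + 1) = S₂ * Z₂

end Problem

end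

end PJBSVD

open PJBSVD

/-! Everything rests on one identity. Let `v i`, `w i` be right and left singular vectors of `H`,
and let `P` have orthonormal columns. Computing tr(PᴴH) in the basis `v` gives 2(‖H‖_tr − Re
tr(PᴴH)) = ∑ σᵢ‖wᵢ − Pvᵢ‖² (`IsSVD.polarGap_eq`). So the gap is nonnegative, and it vanishes exactly
when H vᵢ = σᵢ P vᵢ for all i, which is the polar form of the KKT conditions. Moreover, σ_min ∑ ‖wᵢ
− Pvᵢ‖² is at most twice the gap, and this sum bounds both ‖sin Θ‖_F² (when σ_min > 0) and the
relative residual.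

All iterates have orthonormal columns, so `f` is bounded along them. The progress hypothesis makes c
times each gap at most an increment of `f`; hence `f` increases to a limit and the gaps are
summable. Comparison gives the four series. Along a convergent subsequence the gaps tend to zero,
and `polarGap_nonpos_of_tendsto` passes this to the limit. -/

noncomputable section

open scoped Matrix ComplexOrder InnerProductSpace
open Filter Topology

/-! ### Singular vectors and Hilbert–Schmidt norms of linear maps. -/

namespace LinearMap

variable {E F : Type*} [NormedAddCommGroup E] [InnerProductSpace ℂ E] [FiniteDimensional ℂ E]
  [NormedAddCommGroup F] [InnerProductSpace ℂ F] [FiniteDimensional ℂ F]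

/-- The right singular vectors are mapped to orthogonal vectors, whose norms are the singular
values. -/
theorem inner_apply_eigenvectorBasis (T : E →ₗ[ℂ] F) {k : ℕ} (hk : Module.finrank ℂ E = k)
    (i j : Fin k) :
    ⟪T (T.isSymmetric_adjoint_comp_self.eigenvectorBasis hk i),
      T (T.isSymmetric_adjoint_comp_self.eigenvectorBasis hk j)⟫_ℂ =
      if i = j then ((T.singularValues j : ℂ)) ^ 2 else 0 := by
  rw [← adjoint_inner_right, ← comp_apply,
    T.isSymmetric_adjoint_comp_self.apply_eigenvectorBasis hk j, inner_smul_right,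
    orthonormal_iff_ite.mp (OrthonormalBasis.orthonormal _), ← T.sq_singularValues_fin hk]
  split_ifs <;> simp

theorem norm_apply_eigenvectorBasis (T : E →ₗ[ℂ] F) {k : ℕ} (hk : Module.finrank ℂ E = k)
    (i : Fin k) :
    ‖T (T.isSymmetric_adjoint_comp_self.eigenvectorBasis hk i)‖ = T.singularValues i := by
  have h := T.inner_apply_eigenvectorBasis hk i i
  rw [if_pos rfl, inner_self_eq_norm_sq_to_K] at h
  have hsq : ‖T (T.isSymmetric_adjoint_comp_self.eigenvectorBasis hk i)‖ ^ 2 =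
    T.singularValues i ^ 2 := Complex.ofReal_injective (by simpa using h)
  exact (sq_eq_sq₀ (norm_nonneg _) (T.singularValues_nonneg _)).mp hsq

/-- Existence of a singular value decomposition, for a map into a space of no smaller dimension. -/
theorem exists_singularValueDecomposition (T : E →ₗ[ℂ] F) {k : ℕ}
    (hk : Module.finrank ℂ E = k) (hF : k ≤ Module.finrank ℂ F) :
    ∃ (v : OrthonormalBasis (Fin k) ℂ E) (w : Fin k → F), Orthonormal ℂ w ∧
      ∀ i, T (v i) = (T.singularValues i : ℂ) • w i := by
  set v := T.isSymmetric_adjoint_comp_self.eigenvectorBasis hk with hv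
  -- The normalized images are orthonormal on `s`, where σ ≠ 0. Off `s` the values of `x` are
  -- irrelevant: the extension theorem replaces them.
  let x : Fin (Module.finrank ℂ F) → F := fun i =>
    if h : (i : ℕ) < k then ((T.singularValues i : ℂ))⁻¹ • T (v ⟨i, h⟩) else 0
  let s : Set (Fin (Module.finrank ℂ F)) := {i | (i : ℕ) < k ∧ T.singularValues i ≠ 0}
  have hx : Orthonormal ℂ (s.domRestrict x) := by
    rw [orthonormal_iff_ite]
    rintro ⟨i, hi, hsi⟩ ⟨j, hj, hsj⟩
    simp only [Set.domRestrict_apply, x, dif_pos hi, dif_pos hj, inner_smul_left,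
      inner_smul_right, hv, T.inner_apply_eigenvectorBasis hk, Subtype.mk.injEq, Fin.mk.injEq,
      Fin.val_inj]
    split_ifs with h
    · subst h
      have : (T.singularValues i : ℂ) ≠ 0 := by exact_mod_cast hsi
      simp only [map_inv₀, Complex.conj_ofReal]
      field_simp
    · simp
  obtain ⟨b, hb⟩ := hx.exists_orthonormalBasis_extension_of_card_eq (by simp)
  refine ⟨v, fun i => b (Fin.castLE hF i), b.orthonormal.comp _ (Fin.castLE_injective hF), ?_⟩
  intro i
  -- When σᵢ = 0 the image of `v i` has norm zero, so any unit vector supplied by the extension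
  -- serves as `w i`.
  by_cases h0 : T.singularValues i = 0
  · have := T.norm_apply_eigenvectorBasis hk i
    rw [h0, norm_eq_zero] at this
    rw [h0, hv, this]
    simp
  · have hne : (T.singularValues i : ℂ) ≠ 0 := by exact_mod_cast h0
    have hbi : b (Fin.castLE hF i) = x (Fin.castLE hF i) := hb _ ⟨i.2, h0⟩
    simp only [hbi]
    simp only [x, Fin.val_castLE, i.2, dif_pos, Fin.eta, smul_smul, mul_inv_cancel₀ hne, one_smul]

/-- The Hilbert–Schmidt norm of a linear map and of its adjoint agree. -/
theorem sum_norm_sq_apply_eq_adjoint (T : E →ₗ[ℂ] F) {ι κ : Type*} [Fintype ι] [Fintype κ]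
    (b : OrthonormalBasis ι ℂ E) (c : OrthonormalBasis κ ℂ F) :
    ∑ i, ‖T (b i)‖ ^ 2 = ∑ j, ‖adjoint T (c j)‖ ^ 2 := by
  -- Parseval turns both sides into the same double sum of squared matrix entries.
  simp_rw [← c.sum_sq_norm_inner_right (T _), ← b.sum_sq_norm_inner_left (adjoint T _)]
  rw [Finset.sum_comm]
  simp_rw [adjoint_inner_left]

/-- The Hilbert–Schmidt norm does not depend on the orthonormal basis. -/
theorem sum_norm_sq_apply_eq (T : E →ₗ[ℂ] F) {ι κ : Type*} [Fintype ι] [Fintype κ]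
    (b : OrthonormalBasis ι ℂ E) (c : OrthonormalBasis κ ℂ E) :
    ∑ i, ‖T (b i)‖ ^ 2 = ∑ j, ‖T (c j)‖ ^ 2 := by
  rw [T.sum_norm_sq_apply_eq_adjoint b (stdOrthonormalBasis ℂ F),
    T.sum_norm_sq_apply_eq_adjoint c (stdOrthonormalBasis ℂ F)]

end LinearMap

/-- An orthonormal basis of `X` consisting of principal vectors with respect to `Y`. -/
theorem Submodule.exists_orthonormalBasis_norm_sub_starProjection
    {E : Type*} [NormedAddCommGroup E] [InnerProductSpace ℂ E] [FiniteDimensional ℂ E]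
    (X Y : Submodule ℂ E) :
    ∃ e : OrthonormalBasis (Fin (Module.finrank ℂ X)) ℂ X, ∀ i,
      ‖(e i : E) - Y.starProjection (e i : E)‖ ^ 2 =
        1 - (LinearMap.singularValues (𝕜 := ℂ) (E := X) (F := Y)
          (Y.orthogonalProjectionOnto.toLinearMap ∘ₗ X.subtype) i) ^ 2 := by
  let T : LinearMap (M := X) (M₂ := Y) (RingHom.id ℂ) :=
    Y.orthogonalProjectionOnto.toLinearMap ∘ₗ X.subtype
  refine ⟨(LinearMap.isSymmetric_adjoint_comp_self (𝕜 := ℂ) (E := X) (F := Y) T).eigenvectorBasis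
    rfl, fun i => ?_⟩
  have h1 := LinearMap.norm_apply_eigenvectorBasis (E := X) (F := Y) T rfl i
  have h3 := ((LinearMap.isSymmetric_adjoint_comp_self (𝕜 := ℂ) (E := X) (F := Y) T
    ).eigenvectorBasis rfl).norm_eq_one i
  rw [← h1]
  generalize (LinearMap.isSymmetric_adjoint_comp_self (𝕜 := ℂ) (E := X) (F := Y) T
    ).eigenvectorBasis rfl i = x at h3 ⊢
  have h2 : ‖T x‖ = ‖Y.starProjection (x : E)‖ := rfl
  -- Pythagoras for the unit vector `x`: its squared distance from `Y` is one minus the squared norm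
  -- of its projection, which is the singular value squared.
  have h4 := Y.norm_sq_eq_add_norm_sq_starProjection (x : E)
  rw [Submodule.starProjection_orthogonal'] at h4
  simp only [sub_apply, one_apply_eq_self] at h4
  rw [Submodule.coe_norm] at h3
  rw [h3] at h4
  rw [h2]
  linarith

/-! ### Traces, Frobenius norms and orthonormal columns. -/

namespace Matrix

variable {m n k : ℕ}

/-- Basis independence of the trace; it is used with the right singular vectors of `B`. -/
theorem trace_conjTranspose_mul_eq_sum_inner {ι : Type*} [Fintype ι]
    (A B : Matrix (Fin n) (Fin k) ℂ) (v : OrthonormalBasis ι ℂ (EuclideanSpace ℂ (Fin k))) :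
    trace (Aᴴ * B) = ∑ i, ⟪toEuclideanLin A (v i), toEuclideanLin B (v i)⟫_ℂ := by
  have h : trace (Aᴴ * B) = LinearMap.trace ℂ _ (toEuclideanLin (Aᴴ * B)) := by
    rw [toEuclideanLin_eq_toLin_orthonormal, Matrix.trace_toLin_eq]
  rw [h, LinearMap.trace_eq_sum_inner _ v]
  refine Finset.sum_congr rfl fun i _ => ?_
  rw [toLpLin_mul_same, LinearMap.comp_apply, toEuclideanLin_conjTranspose_eq_adjoint,
    LinearMap.adjoint_inner_right]

theorem frobNorm_sq_eq_sum_norm_sq {ι : Type*} [Fintype ι]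
    (A : Matrix (Fin n) (Fin k) ℂ) (v : OrthonormalBasis ι ℂ (EuclideanSpace ℂ (Fin k))) :
    frobNorm A ^ 2 = ∑ i, ‖toEuclideanLin A (v i)‖ ^ 2 := by
  rw [LinearMap.sum_norm_sq_apply_eq _ v (EuclideanSpace.basisFun (Fin k) ℂ), frobNorm_sq,
    Finset.sum_comm]
  refine Finset.sum_congr rfl fun j _ => ?_
  rw [EuclideanSpace.norm_sq_eq]
  simp [toLpLin_apply]

theorem adjoint_toEuclideanLin_apply_of_mem_stiefel {P : Matrix (Fin n) (Fin k) ℂ}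
    (hP : P ∈ stiefel n k) (x : EuclideanSpace ℂ (Fin k)) :
    LinearMap.adjoint (toEuclideanLin P) (toEuclideanLin P x) = x := by
  rw [← toEuclideanLin_conjTranspose_eq_adjoint, ← LinearMap.comp_apply, ← toLpLin_mul_same,
    show Pᴴ * P = 1 from hP]
  simp

theorem inner_toEuclideanLin_of_mem_stiefel {P : Matrix (Fin n) (Fin k) ℂ}
    (hP : P ∈ stiefel n k) (x y : EuclideanSpace ℂ (Fin k)) :
    ⟪toEuclideanLin P x, toEuclideanLin P y⟫_ℂ = ⟪x, y⟫_ℂ := by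
  rw [← LinearMap.adjoint_inner_right, adjoint_toEuclideanLin_apply_of_mem_stiefel hP]

theorem norm_toEuclideanLin_of_mem_stiefel {P : Matrix (Fin n) (Fin k) ℂ}
    (hP : P ∈ stiefel n k) (x : EuclideanSpace ℂ (Fin k)) : ‖toEuclideanLin P x‖ = ‖x‖ := by
  rw [@norm_eq_sqrt_re_inner ℂ, @norm_eq_sqrt_re_inner ℂ _ _ _ _ x,
    inner_toEuclideanLin_of_mem_stiefel hP]

theorem mem_stiefel_of_inner {P : Matrix (Fin n) (Fin k) ℂ}
    (hP : ∀ x y : EuclideanSpace ℂ (Fin k),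
      ⟪toEuclideanLin P x, toEuclideanLin P y⟫_ℂ = ⟪x, y⟫_ℂ) : P ∈ stiefel n k := by
  refine (toEuclideanLin (𝕜 := ℂ) (m := Fin k) (n := Fin k)).injective ?_
  refine LinearMap.ext fun x => ext_inner_left ℂ fun y => ?_
  rw [toLpLin_mul_same, LinearMap.comp_apply, toEuclideanLin_conjTranspose_eq_adjoint,
    LinearMap.adjoint_inner_right, hP]
  simp

/-- `I − PPᴴ` is an orthogonal projection: the squared norm drops by ‖Pᴴx‖². -/
theorem norm_sub_le_of_mem_stiefel {P : Matrix (Fin n) (Fin k) ℂ}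
    (hP : P ∈ stiefel n k) (x : EuclideanSpace ℂ (Fin n)) :
    ‖x - toEuclideanLin P (LinearMap.adjoint (toEuclideanLin P) x)‖ ≤ ‖x‖ := by
  refine le_of_sq_le_sq ?_ (norm_nonneg _)
  rw [@norm_sub_sq ℂ, norm_toEuclideanLin_of_mem_stiefel hP, ← LinearMap.adjoint_inner_left,
    inner_self_eq_norm_sq]
  nlinarith [sq_nonneg ‖LinearMap.adjoint (toEuclideanLin P) x‖]

theorem stiefel_mul {S : Matrix (Fin n) (Fin m) ℂ} {Z : Matrix (Fin m) (Fin k) ℂ}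
    (hS : S ∈ stiefel n m) (hZ : Z ∈ stiefel m k) : S * Z ∈ stiefel n k := by
  change (S * Z)ᴴ * (S * Z) = 1
  rw [conjTranspose_mul, Matrix.mul_assoc, ← Matrix.mul_assoc Sᴴ, show Sᴴ * S = 1 from hS,
    Matrix.one_mul, show Zᴴ * Z = 1 from hZ]

theorem isClosed_stiefel (n k : ℕ) : IsClosed (stiefel n k) :=
  isClosed_eq (by fun_prop) continuous_const

theorem frobNorm_sq_of_mem_stiefel {P : Matrix (Fin n) (Fin k) ℂ} (hP : P ∈ stiefel n k) :
    frobNorm P ^ 2 = k := by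
  rw [frobNorm_sq_eq_sum_norm_sq P (EuclideanSpace.basisFun (Fin k) ℂ)]
  simp only [norm_toEuclideanLin_of_mem_stiefel hP, OrthonormalBasis.norm_eq_one]
  simp

/-! ### The gap in terms of a singular value decomposition. -/

/-- Orthonormal vectors `v i`, `w i` are a singular value decomposition of `H`. -/
structure IsSVD (H : Matrix (Fin n) (Fin k) ℂ)
    (v : OrthonormalBasis (Fin k) ℂ (EuclideanSpace ℂ (Fin k)))
    (w : Fin k → EuclideanSpace ℂ (Fin n)) : Prop where
  orthonormal : Orthonormal ℂ w
  apply_eq : ∀ i, toEuclideanLin H (v i) = (singVal H i : ℂ) • w i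

theorem exists_isSVD (hkn : k ≤ n) (H : Matrix (Fin n) (Fin k) ℂ) : ∃ v w, IsSVD H v w := by
  obtain ⟨v, w, hw, h⟩ := (toEuclideanLin H).exists_singularValueDecomposition
    (k := k) (by simp) (by simpa using hkn)
  exact ⟨v, w, hw, h⟩

theorem singVal_nonneg (H : Matrix (Fin n) (Fin k) ℂ) (i : ℕ) : 0 ≤ singVal H i :=
  LinearMap.singularValues_nonneg _ _

theorem sigmaMin_le_singVal (hkn : k ≤ n) (H : Matrix (Fin n) (Fin k) ℂ) (i : Fin k) :
    sigmaMin H ≤ singVal H i :=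
  LinearMap.singularValues_antitone _ (by rw [min_eq_right hkn]; omega)

theorem traceNorm_eq_sum (hkn : k ≤ n) (H : Matrix (Fin n) (Fin k) ℂ) :
    traceNorm H = ∑ i : Fin k, singVal H i := by
  rw [traceNorm, min_eq_right hkn, Finset.sum_range]

namespace IsSVD

variable {P H : Matrix (Fin n) (Fin k) ℂ}
  {v : OrthonormalBasis (Fin k) ℂ (EuclideanSpace ℂ (Fin k))}
  {w : Fin k → EuclideanSpace ℂ (Fin n)}

/-- Both `w i` and `P (v i)` are unit vectors, so ‖wᵢ − Pvᵢ‖² = 2 − 2 Re⟨Pvᵢ, wᵢ⟩; weighting by σᵢ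
and summing yields the trace norm minus the trace. -/
theorem polarGap_eq (h : IsSVD H v w) (hkn : k ≤ n) (hP : P ∈ stiefel n k) :
    2 * polarGap P H = ∑ i : Fin k, singVal H i * ‖w i - toEuclideanLin P (v i)‖ ^ 2 := by
  rw [polarGap, traceNorm_eq_sum hkn, trace_conjTranspose_mul_eq_sum_inner P H v, Complex.re_sum,
    ← Finset.sum_sub_distrib, Finset.mul_sum]
  refine Finset.sum_congr rfl fun i _ => ?_
  rw [@norm_sub_sq ℂ, norm_toEuclideanLin_of_mem_stiefel hP, v.norm_eq_one, h.orthonormal.1 i,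
    h.apply_eq, inner_smul_right, Complex.re_ofReal_mul, inner_re_symm]
  simp only [RCLike.re_to_complex]
  ring

theorem frobNorm_sq_eq (h : IsSVD H v w) : frobNorm H ^ 2 = ∑ i : Fin k, singVal H i ^ 2 := by
  rw [frobNorm_sq_eq_sum_norm_sq H v]
  refine Finset.sum_congr rfl fun i _ => ?_
  rw [h.apply_eq, norm_smul, h.orthonormal.1 i, mul_one, Complex.norm_real, Real.norm_eq_abs,
    sq_abs]

theorem sigmaMin_mul_sum_le (h : IsSVD H v w) (hkn : k ≤ n) (hP : P ∈ stiefel n k) :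
    sigmaMin H * ∑ i, ‖w i - toEuclideanLin P (v i)‖ ^ 2 ≤ 2 * polarGap P H := by
  rw [h.polarGap_eq hkn hP, Finset.mul_sum]
  exact Finset.sum_le_sum fun i _ =>
    mul_le_mul_of_nonneg_right (sigmaMin_le_singVal hkn H i) (sq_nonneg _)

/-- The projection of `H` off the column space of `P`, relative to `H`. -/
theorem frobNorm_sub_sq_le (h : IsSVD H v w) (hP : P ∈ stiefel n k) :
    frobNorm (H - P * (Pᴴ * H)) ^ 2 ≤
      frobNorm H ^ 2 * ∑ i, ‖w i - toEuclideanLin P (v i)‖ ^ 2 := by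
  rw [frobNorm_sq_eq_sum_norm_sq _ v, Finset.mul_sum]
  refine Finset.sum_le_sum fun i _ => ?_
  -- `I − PPᴴ` annihilates `P (v i)`, so subtracting that vector from `w i` is free and brings in
  -- the difference that the gap controls.
  have h1 : toEuclideanLin (H - P * (Pᴴ * H)) (v i) = (singVal H i : ℂ) •
      ((w i - toEuclideanLin P (v i)) - toEuclideanLin P
        (LinearMap.adjoint (toEuclideanLin P) (w i - toEuclideanLin P (v i)))) := by
    rw [map_sub, LinearMap.sub_apply, toLpLin_mul_same, toLpLin_mul_same, LinearMap.comp_apply,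
      LinearMap.comp_apply, toEuclideanLin_conjTranspose_eq_adjoint, h.apply_eq,
      map_sub (LinearMap.adjoint _), adjoint_toEuclideanLin_apply_of_mem_stiefel hP]
    simp only [map_smul, map_sub]
    module
  rw [h1, norm_smul, mul_pow, Complex.norm_real, Real.norm_eq_abs, sq_abs]
  refine mul_le_mul ?_ ?_ (sq_nonneg _) (sq_nonneg _)
  · rw [h.frobNorm_sq_eq]
    exact Finset.single_le_sum (f := fun i : Fin k => singVal H i ^ 2)
      (fun i _ => sq_nonneg _) (Finset.mem_univ i)
  · gcongr
    exact norm_sub_le_of_mem_stiefel hP _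

/-- An orthonormal polar factor attains the trace norm. -/
theorem exists_stiefel_polarGap_eq_zero (h : IsSVD H v w) (hkn : k ≤ n) :
    ∃ Q ∈ stiefel n k, polarGap Q H = 0 := by
  -- The polar factor sends each `v i` to `w i`, so every term of the gap identity vanishes.
  let T : EuclideanSpace ℂ (Fin k) →ₗ[ℂ] EuclideanSpace ℂ (Fin n) := v.toBasis.constr ℂ w
  have hT : ∀ i, T (v i) = w i := fun i => by
    rw [← v.coe_toBasis]; exact v.toBasis.constr_basis ℂ w i
  have hQ : toEuclideanLin.symm T ∈ stiefel n k := by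
    refine mem_stiefel_of_inner fun x y => ?_
    rw [LinearEquiv.apply_symm_apply]
    exact (T.isometryOfOrthonormal (v := v.toBasis) (by simp)
      (by simpa [Function.comp_def, hT] using h.orthonormal)).inner_map_map x y
  refine ⟨_, hQ, ?_⟩
  have := h.polarGap_eq hkn hQ
  rw [LinearEquiv.apply_symm_apply] at this
  simpa [hT] using this

/-- Equality in the trace norm inequality characterizes orthonormal polar factors. -/
theorem apply_eq_of_polarGap_nonpos (h : IsSVD H v w) (hkn : k ≤ n) (hP : P ∈ stiefel n k)
    (h0 : polarGap P H ≤ 0) (i : Fin k) :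
    toEuclideanLin H (v i) = (singVal H i : ℂ) • toEuclideanLin P (v i) := by
  have hnn : ∀ i : Fin k, 0 ≤ singVal H i * ‖w i - toEuclideanLin P (v i)‖ ^ 2 :=
    fun i => mul_nonneg (singVal_nonneg H i) (sq_nonneg _)
  have hle : singVal H i * ‖w i - toEuclideanLin P (v i)‖ ^ 2 ≤ 2 * polarGap P H := by
    rw [h.polarGap_eq hkn hP]
    exact Finset.single_le_sum (f := fun i : Fin k => singVal H i *
      ‖w i - toEuclideanLin P (v i)‖ ^ 2) (fun i _ => hnn i) (Finset.mem_univ i)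
  -- A sum of nonnegative terms that is at most zero has only zero terms: either σᵢ = 0 or wᵢ = Pvᵢ.
  have hz : singVal H i * ‖w i - toEuclideanLin P (v i)‖ ^ 2 = 0 :=
    le_antisymm (by linarith) (hnn i)
  rw [h.apply_eq]
  rcases mul_eq_zero.mp hz with hs | hs
  · simp [hs]
  · rw [sub_eq_zero.mp (norm_eq_zero.mp (pow_eq_zero_iff two_ne_zero |>.mp hs))]

/-- With all σᵢ positive, each `w i` is a multiple of `H (v i)`. Without positivity, a `w i` with σᵢ
= 0 need not lie in the range. -/
theorem colSpace_eq (h : IsSVD H v w) (hkn : k ≤ n) (hH : 0 < sigmaMin H) :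
    colSpace H = Submodule.span ℂ (Set.range w) := by
  have hr : LinearMap.range (toEuclideanLin H) =
      Submodule.span ℂ (Set.range fun i => toEuclideanLin H (v i)) := by
    rw [← Submodule.map_top, ← v.toBasis.span_eq, Submodule.map_span, ← Set.range_comp,
      v.coe_toBasis]
    rfl
  rw [colSpace, hr]
  refine le_antisymm (Submodule.span_le.mpr ?_) (Submodule.span_le.mpr ?_)
  · rintro _ ⟨i, rfl⟩
    simp only [h.apply_eq]
    exact Submodule.smul_mem _ _ (Submodule.subset_span ⟨i, rfl⟩)
  · rintro _ ⟨i, rfl⟩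
    have h0 : (singVal H i : ℂ) ≠ 0 := by
      exact_mod_cast (hH.trans_le (sigmaMin_le_singVal hkn H i)).ne'
    have : w i = (singVal H i : ℂ)⁻¹ • toEuclideanLin H (v i) := by
      rw [h.apply_eq, smul_smul, inv_mul_cancel₀ h0, one_smul]
    rw [this]
    exact Submodule.smul_mem _ _ (Submodule.subset_span ⟨i, rfl⟩)

end IsSVD

-- Canonical angles.

attribute [local instance] Matrix.frobeniusNormedAddCommGroup in
/-- The sines of the canonical angles are bounded by the distances of an orthonormal basis of the
first subspace from the second. -/
theorem frobNorm_sinTheta_sq_le {X Y : Submodule ℂ (EuclideanSpace ℂ (Fin n))}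
    {ι : Type*} [Fintype ι] (b : OrthonormalBasis ι ℂ X) :
    frobNorm (sinTheta X Y) ^ 2 ≤
      ∑ i, ‖(b i : EuclideanSpace ℂ (Fin n)) - Y.starProjection (b i)‖ ^ 2 := by
  obtain ⟨e, he⟩ := X.exists_orthonormalBasis_norm_sub_starProjection Y
  -- The right-hand side is the squared Hilbert–Schmidt norm of `D`, so `b` may be exchanged for the
  -- principal basis `e`, whose distances are the sines.
  let D : X →ₗ[ℂ] EuclideanSpace ℂ (Fin n) := X.subtype - Y.starProjection.toLinearMap ∘ₗ X.subtype
  have hb : ∑ i, ‖(b i : EuclideanSpace ℂ (Fin n)) - Y.starProjection (b i)‖ ^ 2 =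
      ∑ i, ‖(e i : EuclideanSpace ℂ (Fin n)) - Y.starProjection (e i)‖ ^ 2 :=
    D.sum_norm_sq_apply_eq b e
  have hterm : ∀ i, ‖(e i : EuclideanSpace ℂ (Fin n)) - Y.starProjection (e i)‖ ^ 2 =
      Real.sin (canonicalAngle X Y i) ^ 2 := by
    intro i
    rw [canonicalAngle, Real.sin_arccos, Real.sq_sqrt (by rw [← he]; exact sq_nonneg _), he]
  have hsum : frobNorm (sinTheta X Y) ^ 2 =
      ∑ i ∈ Finset.range (min (Module.finrank ℂ X) (Module.finrank ℂ Y)),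
        Real.sin (canonicalAngle X Y i) ^ 2 := by
    rw [frobNorm, sinTheta, frobenius_norm_diagonal, EuclideanSpace.norm_sq_eq, Finset.sum_range]
    simp
  rw [hsum, hb, Finset.sum_congr rfl fun i _ => hterm i,
    ← Finset.sum_range fun i => Real.sin (canonicalAngle X Y i) ^ 2]
  -- `e` has dim X vectors while only min(dim X, dim Y) angles count; the surplus terms are
  -- nonnegative.
  exact Finset.sum_le_sum_of_subset_of_nonneg
    (Finset.range_subset_range.mpr (min_le_left _ _)) fun _ _ _ => sq_nonneg _

/-! ### What the gap controls. -/

variable {P H : Matrix (Fin n) (Fin k) ℂ}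

theorem polarGap_nonneg (hkn : k ≤ n) (hP : P ∈ stiefel n k) : 0 ≤ polarGap P H := by
  obtain ⟨v, w, h⟩ := exists_isSVD hkn H
  have h1 := h.polarGap_eq hkn hP
  have h2 : 0 ≤ ∑ i : Fin k, singVal H i * ‖w i - toEuclideanLin P (v i)‖ ^ 2 :=
    Finset.sum_nonneg fun i _ => mul_nonneg (singVal_nonneg H i) (sq_nonneg _)
  linarith

theorem sigmaMin_nonneg (H : Matrix (Fin n) (Fin k) ℂ) : 0 ≤ sigmaMin H := singVal_nonneg H _

theorem sigmaMin_mul_ratio_le (hkn : k ≤ n) (hP : P ∈ stiefel n k) :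
    sigmaMin H * (frobNorm (H - P * (Pᴴ * H)) ^ 2 / frobNorm H ^ 2) ≤ 2 * polarGap P H := by
  obtain ⟨v, w, h⟩ := exists_isSVD hkn H
  refine le_trans (mul_le_mul_of_nonneg_left ?_ (sigmaMin_nonneg H)) (h.sigmaMin_mul_sum_le hkn hP)
  -- This form of the division bound also covers `H = 0`, where the quotient is `0`.
  exact div_le_of_le_mul₀ (sq_nonneg _) (Finset.sum_nonneg fun _ _ => sq_nonneg _)
    ((h.frobNorm_sub_sq_le hP).trans_eq (mul_comm _ _))

theorem sigmaMin_mul_sinTheta_le (hkn : k ≤ n) (hP : P ∈ stiefel n k) :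
    sigmaMin H * frobNorm (sinTheta (colSpace H) (colSpace P)) ^ 2 ≤ 2 * polarGap P H := by
  -- If σ_min = 0 the column space need not be the span of the `w i`, but the left side is zero.
  rcases (sigmaMin_nonneg H).eq_or_lt with h0 | h0
  · rw [← h0, zero_mul]
    exact mul_nonneg zero_le_two (polarGap_nonneg hkn hP)
  obtain ⟨v, w, h⟩ := exists_isSVD hkn H
  refine le_trans (mul_le_mul_of_nonneg_left ?_ (sigmaMin_nonneg H)) (h.sigmaMin_mul_sum_le hkn hP)
  rw [h.colSpace_eq hkn h0]
  have hspan : Orthonormal ℂ (fun i => (⟨w i, Submodule.subset_span ⟨i, rfl⟩⟩ :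
      Submodule.span ℂ (Set.range w))) :=
    h.orthonormal.codRestrict _ _
  let b := OrthonormalBasis.mk hspan 
    ((Submodule.span_range_subtype_eq_top_iff _ _).mpr rfl).ge
  refine (frobNorm_sinTheta_sq_le b).trans (Finset.sum_le_sum fun i _ => ?_)
  have hb : (b i : EuclideanSpace ℂ (Fin n)) = w i := by simp [b]
  -- The distance from `w i` to the column space of `P` is an infimum, for which `P (v i)` is a
  -- competitor.
  rw [hb, Submodule.starProjection_minimal]
  have := ciInf_le (f := fun x : colSpace P => ‖w i - x‖)
    ⟨0, by rintro _ ⟨x, rfl⟩; exact norm_nonneg _⟩ ⟨toEuclideanLin P (v i), ⟨v i, rfl⟩⟩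
  exact pow_le_pow_left₀ (Real.iInf_nonneg fun _ => norm_nonneg _) this 2

/-- With gap zero, `H` and `P` agree on `v i` up to the factor σᵢ, so `PᴴH` is diagonal in the basis
`v` with eigenvalues σᵢ ≥ 0. -/
theorem eq_mul_and_posSemidef_of_polarGap_nonpos (hkn : k ≤ n) (hP : P ∈ stiefel n k)
    (h0 : polarGap P H ≤ 0) : H = P * (Pᴴ * H) ∧ (Pᴴ * H).PosSemidef := by
  obtain ⟨v, w, h⟩ := exists_isSVD hkn H
  have hv := h.apply_eq_of_polarGap_nonpos hkn hP h0
  have hL : ∀ i, toEuclideanLin (Pᴴ * H) (v i) = (singVal H i : ℂ) • v i := fun i => by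
    rw [toLpLin_mul_same, LinearMap.comp_apply, toEuclideanLin_conjTranspose_eq_adjoint, hv,
      map_smul, adjoint_toEuclideanLin_apply_of_mem_stiefel hP]
  constructor
  · refine (toEuclideanLin (𝕜 := ℂ) (m := Fin n) (n := Fin k)).injective ?_
    refine v.toBasis.ext fun i => ?_
    rw [v.coe_toBasis, toLpLin_mul_same, LinearMap.comp_apply, hL, hv, map_smul]
  · rw [← isPositive_toEuclideanLin_iff, LinearMap.isPositive_iff_complex]
    intro x
    have hx : toEuclideanLin (Pᴴ * H) x = ∑ i, ⟪v i, x⟫_ℂ • (singVal H i : ℂ) • v i := by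
      conv_lhs => rw [← v.sum_repr' x]
      simp only [map_sum, map_smul, hL]
    have hin : ⟪toEuclideanLin (Pᴴ * H) x, x⟫_ℂ =
        ((∑ i : Fin k, singVal H i * ‖⟪v i, x⟫_ℂ‖ ^ 2 : ℝ) : ℂ) := by
      rw [hx, sum_inner]
      push_cast
      refine Finset.sum_congr rfl fun i _ => ?_
      rw [inner_smul_left, inner_smul_left, Complex.conj_ofReal, ← Complex.conj_mul']
      ring
    rw [hin]
    refine ⟨rfl, ?_⟩
    rw [RCLike.re_to_complex, Complex.ofReal_re]
    exact Finset.sum_nonneg fun i _ => mul_nonneg (singVal_nonneg H i) (sq_nonneg _)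

theorem tendsto_re_trace_conjTranspose_mul {Q G : ℕ → Matrix (Fin n) (Fin k) ℂ}
    (hQ : Tendsto Q atTop (𝓝 P)) (hG : Tendsto G atTop (𝓝 H)) :
    Tendsto (fun i => (trace ((Q i)ᴴ * G i)).re) atTop (𝓝 (trace (Pᴴ * H)).re) := by
  have hc : Continuous fun x : Matrix (Fin n) (Fin k) ℂ × Matrix (Fin n) (Fin k) ℂ =>
      (trace (x.1ᴴ * x.2)).re := by fun_prop
  have h := hc.tendsto (P, H)
  have hcomp := h.comp (hQ.prodMk_nhds hG)
  simpa only [Function.comp_def] using hcomp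

/-- A limit of pairs `(Q i, G i)` whose gaps tend to zero has gap zero. -/
theorem polarGap_nonpos_of_tendsto (hkn : k ≤ n) {Q G : ℕ → Matrix (Fin n) (Fin k) ℂ}
    (hQ : Tendsto Q atTop (𝓝 P)) (hG : Tendsto G atTop (𝓝 H))
    (hgap : Tendsto (fun i => polarGap (Q i) (G i)) atTop (𝓝 0)) : polarGap P H ≤ 0 := by
  obtain ⟨v, w, h⟩ := exists_isSVD hkn H
  -- No continuity of the trace norm is needed: Re tr(RᴴG) is continuous in `G`, bounds ‖G‖_tr from
  -- below, and equals it at `G = H`.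
  obtain ⟨R, hR, hR0⟩ := h.exists_stiefel_polarGap_eq_zero hkn
  have h1 := tendsto_re_trace_conjTranspose_mul (tendsto_const_nhds (x := R)) hG
  have h2 := hgap.add (tendsto_re_trace_conjTranspose_mul hQ hG)
  have hle : ∀ i, (trace (Rᴴ * G i)).re ≤
      polarGap (Q i) (G i) + (trace ((Q i)ᴴ * G i)).re := fun _ =>
    (sub_nonneg.mp (polarGap_nonneg hkn hR)).trans_eq (sub_add_cancel _ _).symm
  have h3 := le_of_tendsto_of_tendsto' h1 h2 hle
  rw [zero_add, ← sub_eq_zero.mp hR0] at h3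
  exact sub_nonpos.mpr h3

end Matrix

/-! ### Continuity, boundedness and orthonormality for the iteration. -/

namespace PJBSVD

variable {k n₁ n₂ N : ℕ} {τ : Composition k} {B : Fin N → Matrix (Fin n₁) (Fin n₂) ℂ}

theorem continuous_blockDiagPart (τ : Composition k) : Continuous (blockDiagPart τ) := by
  refine continuous_matrix fun i j => ?_
  by_cases h : τ.index i = τ.index j
  · simpa [blockDiagPart, h] using continuous_id.matrix_elem i j
  · simpa [blockDiagPart, h] using continuous_const

theorem continuous_gradU (τ : Composition k) (B : Fin N → Matrix (Fin n₁) (Fin n₂) ℂ) :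
    Continuous fun x : Matrix (Fin n₁) (Fin k) ℂ × Matrix (Fin n₂) (Fin k) ℂ =>
      gradU τ B x.1 x.2 := by
  have := continuous_blockDiagPart τ
  unfold gradU
  fun_prop

theorem continuous_gradV (τ : Composition k) (B : Fin N → Matrix (Fin n₁) (Fin n₂) ℂ) :
    Continuous fun x : Matrix (Fin n₁) (Fin k) ℂ × Matrix (Fin n₂) (Fin k) ℂ =>
      gradV τ B x.1 x.2 := by
  have := continuous_blockDiagPart τ
  unfold gradV
  fun_prop

-- Submultiplicativity together with ‖U‖_F² = ‖V‖_F² = k; the bound is crude, but uniform over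
-- orthonormal pairs.
attribute [local instance] Matrix.frobeniusNormedAddCommGroup in
theorem objective_le (τ : Composition k) (B : Fin N → Matrix (Fin n₁) (Fin n₂) ℂ)
    {U : Matrix (Fin n₁) (Fin k) ℂ} {V : Matrix (Fin n₂) (Fin k) ℂ}
    (hU : U ∈ stiefel n₁ k) (hV : V ∈ stiefel n₂ k) :
    objective τ B U V ≤ ∑ l, k * frobNorm (B l) ^ 2 * k := by
  refine Finset.sum_le_sum fun l _ => (frobNorm_blockDiagPart_le τ _).trans ?_
  have hle : frobNorm (Uᴴ * B l * V) ≤ frobNorm U * frobNorm (B l) * frobNorm V := by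
    refine (Matrix.frobenius_norm_mul _ _).trans ?_
    refine mul_le_mul_of_nonneg_right ?_ (norm_nonneg _)
    refine (Matrix.frobenius_norm_mul _ _).trans_eq ?_
    rw [Matrix.frobenius_norm_conjTranspose]
    rfl
  have h0 : 0 ≤ frobNorm (Uᴴ * B l * V) := norm_nonneg _
  calc frobNorm (Uᴴ * B l * V) ^ 2 ≤ (frobNorm U * frobNorm (B l) * frobNorm V) ^ 2 :=
        pow_le_pow_left₀ h0 hle 2
    _ = k * frobNorm (B l) ^ 2 * k := by
        rw [mul_pow, mul_pow, Matrix.frobNorm_sq_of_mem_stiefel hU,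
          Matrix.frobNorm_sq_of_mem_stiefel hV]

theorem IsNPDoGaussSeidel.mem_stiefel {U₀ : Matrix (Fin n₁) (Fin k) ℂ}
    {V₀ : Matrix (Fin n₂) (Fin k) ℂ} {U : ℕ → Matrix (Fin n₁) (Fin k) ℂ}
    {V : ℕ → Matrix (Fin n₂) (Fin k) ℂ} (h : IsNPDoGaussSeidel τ B U₀ V₀ U V) (j : ℕ) :
    U j ∈ stiefel n₁ k ∧ V j ∈ stiefel n₂ k := by
  obtain ⟨hU, hV, hU₀, hV₀, hstep⟩ := h
  cases j with
  | zero => exact ⟨hU ▸ hU₀, hV ▸ hV₀⟩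
  | succ j => exact ⟨(hstep j).1.1, (hstep j).2.1⟩

theorem mem_stiefel_of_tendsto {U : ℕ → Matrix (Fin n₁) (Fin k) ℂ}
    {V : ℕ → Matrix (Fin n₂) (Fin k) ℂ} {Us : Matrix (Fin n₁) (Fin k) ℂ}
    {Vs : Matrix (Fin n₂) (Fin k) ℂ} (h : ∀ j, U j ∈ stiefel n₁ k ∧ V j ∈ stiefel n₂ k)
    (hlim : Tendsto (fun i => (U i, V i)) atTop (𝓝 (Us, Vs))) :
    Us ∈ stiefel n₁ k ∧ Vs ∈ stiefel n₂ k :=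
  ((Matrix.isClosed_stiefel n₁ k).prod (Matrix.isClosed_stiefel n₂ k)).mem_of_tendsto hlim
    (Eventually.of_forall h)

/-- Polar factors have orthonormal columns, and the Stiefel manifold is closed, which handles limit
outputs. -/
theorem IsNPDoOutput.mem_stiefel {U₀ Z₁ : Matrix (Fin n₁) (Fin k) ℂ}
    {V₀ Z₂ : Matrix (Fin n₂) (Fin k) ℂ} (h : IsNPDoOutput τ B U₀ V₀ Z₁ Z₂) :
    Z₁ ∈ stiefel n₁ k ∧ Z₂ ∈ stiefel n₂ k := by
  obtain ⟨U, V, hUV, ⟨m, rfl, rfl⟩ | ⟨φ, -, hlim⟩⟩ := h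
  · exact hUV.mem_stiefel m
  · exact mem_stiefel_of_tendsto (fun i => hUV.mem_stiefel (φ i)) hlim

theorem IsAccNPDoGaussSeidel.mem_stiefel {U : ℕ → Matrix (Fin n₁) (Fin k) ℂ}
    {V : ℕ → Matrix (Fin n₂) (Fin k) ℂ} (h : IsAccNPDoGaussSeidel τ B U V) (j : ℕ) :
    U j ∈ stiefel n₁ k ∧ V j ∈ stiefel n₂ k := by
  obtain ⟨hU, hV, hstep⟩ := h
  cases j with
  | zero => exact ⟨hU, hV⟩
  | succ j =>
    obtain ⟨p₁, p₂, S₁, S₂, Z₁, Z₂, hS₁, hS₂, hZ, hU', hV'⟩ := hstep j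
    rw [hU', hV']
    exact ⟨Matrix.stiefel_mul hS₁.1 hZ.mem_stiefel.1, Matrix.stiefel_mul hS₂.1 hZ.mem_stiefel.2⟩

end PJBSVD

/-! ### Summability by telescoping, and the theorem. -/

/-- A nonnegative sequence dominated by the increments of a bounded sequence is summable. -/
theorem summable_of_mul_le_sub {f g : ℕ → ℝ} {c M : ℝ} (hc : 0 < c) (hg : ∀ j, 0 ≤ g j)
    (hf : ∀ j, f j ≤ M) (h : ∀ j, c * g j ≤ f (j + 1) - f j) : Summable g := by
  refine summable_of_sum_range_le (c := (M - f 0) / c) hg fun n => ?_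
  rw [le_div_iff₀ hc, mul_comm, Finset.mul_sum]
  calc ∑ i ∈ Finset.range n, c * g i ≤ ∑ i ∈ Finset.range n, (f (i + 1) - f i) :=
        Finset.sum_le_sum fun i _ => h i
    _ = f n - f 0 := Finset.sum_range_sub f n
    _ ≤ M - f 0 := sub_le_sub_right (hf n) _

end


theorem mainTheorem5 {k n₁ n₂ N : ℕ} (hk : 1 ≤ k) (hkn : k ≤ min n₁ n₂)
    (τ : Composition k) (B : Fin N → Matrix (Fin n₁) (Fin n₂) ℂ)
    (U : ℕ → Matrix (Fin n₁) (Fin k) ℂ) (V : ℕ → Matrix (Fin n₂) (Fin k) ℂ)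
    (hUV : IsAccNPDoGaussSeidel τ B U V)
    (H₁ : ℕ → Matrix (Fin n₁) (Fin k) ℂ) (hH₁ : ∀ j, H₁ j = gradU τ B (U j) (V j))
    (H₂ : ℕ → Matrix (Fin n₂) (Fin k) ℂ) (hH₂ : ∀ j, H₂ j = gradV τ B (U j) (V j))
    (c : ℝ) (hc : 0 < c)
    (hprogress : ∀ j, objective τ B (U (j + 1)) (V (j + 1)) - objective τ B (U j) (V j) ≥
      c * max (polarGap (U j) (H₁ j)) (polarGap (V j) (H₂ j))) :
    (Monotone (fun j => objective τ B (U j) (V j)) ∧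
      ∃ L : ℝ, Filter.Tendsto (fun j => objective τ B (U j) (V j)) Filter.atTop (nhds L)) ∧
    (∀ (Us : Matrix (Fin n₁) (Fin k) ℂ) (Vs : Matrix (Fin n₂) (Fin k) ℂ) (φ : ℕ → ℕ),
      StrictMono φ →
      Filter.Tendsto (fun i => (U (φ i), V (φ i))) Filter.atTop (nhds (Us, Vs)) →
      PolarKKT τ B Us Vs) ∧
    (Summable fun j =>
      sigmaMin (H₁ j) * frobNorm (sinTheta (colSpace (H₁ j)) (colSpace (U j))) ^ 2) ∧
    (Summable fun j =>
      sigmaMin (H₂ j) * frobNorm (sinTheta (colSpace (H₂ j)) (colSpace (V j))) ^ 2) ∧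
    (Summable fun j =>
      sigmaMin (H₁ j) *
        (frobNorm (H₁ j - U j * ((U j).conjTranspose * H₁ j)) ^ 2 / frobNorm (H₁ j) ^ 2)) ∧
    (Summable fun j =>
      sigmaMin (H₂ j) *
        (frobNorm (H₂ j - V j * ((V j).conjTranspose * H₂ j)) ^ 2 / frobNorm (H₂ j) ^ 2)) := by
  have hkn₁ : k ≤ n₁ := hkn.trans (min_le_left _ _)
  have hkn₂ : k ≤ n₂ := hkn.trans (min_le_right _ _)
  have hst := hUV.mem_stiefel
  have hgap₁ : ∀ j, 0 ≤ polarGap (U j) (H₁ j) := fun j => Matrix.polarGap_nonneg hkn₁ (hst j).1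
  have hgap₂ : ∀ j, 0 ≤ polarGap (V j) (H₂ j) := fun j => Matrix.polarGap_nonneg hkn₂ (hst j).2
  have hbdd := fun j => objective_le τ B (hst j).1 (hst j).2
  have hmono : Monotone fun j => objective τ B (U j) (V j) := monotone_nat_of_le_succ fun j =>
    sub_nonneg.mp ((mul_nonneg hc.le ((hgap₁ j).trans (le_max_left _ _))).trans (hprogress j))
  have hsum₁ : Summable fun j => polarGap (U j) (H₁ j) :=
    summable_of_mul_le_sub (f := fun j => objective τ B (U j) (V j)) hc hgap₁ hbdd fun j =>
      (mul_le_mul_of_nonneg_left (le_max_left _ _) hc.le).trans (hprogress j)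
  have hsum₂ : Summable fun j => polarGap (V j) (H₂ j) :=
    summable_of_mul_le_sub (f := fun j => objective τ B (U j) (V j)) hc hgap₂ hbdd fun j =>
      (mul_le_mul_of_nonneg_left (le_max_right _ _) hc.le).trans (hprogress j)
  refine ⟨⟨hmono, _, tendsto_atTop_ciSup hmono ⟨_, by rintro _ ⟨j, rfl⟩; exact hbdd j⟩⟩,
    ?_, ?_, ?_, ?_, ?_⟩
  -- The gradients converge by continuity and the gaps tend to zero by summability, so both limiting
  -- gaps are nonpositive.
  · intro Us Vs φ hφ hlim
    obtain ⟨hUs, hVs⟩ := mem_stiefel_of_tendsto (fun i => hst (φ i)) hlim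
    have hG₁ : Filter.Tendsto (fun i => H₁ (φ i)) Filter.atTop (nhds (gradU τ B Us Vs)) := by
      have h := (continuous_gradU τ B).tendsto (Us, Vs)
      have hcomp := h.comp hlim
      simpa only [Function.comp_def, hH₁] using hcomp
    have hG₂ : Filter.Tendsto (fun i => H₂ (φ i)) Filter.atTop (nhds (gradV τ B Us Vs)) := by
      have h := (continuous_gradV τ B).tendsto (Us, Vs)
      have hcomp := h.comp hlim
      simpa only [Function.comp_def, hH₂] using hcomp
    exact ⟨⟨hUs, Matrix.eq_mul_and_posSemidef_of_polarGap_nonpos hkn₁ hUs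
        (Matrix.polarGap_nonpos_of_tendsto hkn₁ hlim.fst_nhds hG₁
          (hsum₁.tendsto_atTop_zero.comp hφ.tendsto_atTop))⟩,
      ⟨hVs, Matrix.eq_mul_and_posSemidef_of_polarGap_nonpos hkn₂ hVs
        (Matrix.polarGap_nonpos_of_tendsto hkn₂ hlim.snd_nhds hG₂
          (hsum₂.tendsto_atTop_zero.comp hφ.tendsto_atTop))⟩⟩
  -- All four series are compared with twice the summable gaps.
  · exact Summable.of_nonneg_of_le
      (fun j => mul_nonneg (Matrix.sigmaMin_nonneg _) (sq_nonneg _))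
      (fun j => Matrix.sigmaMin_mul_sinTheta_le hkn₁ (hst j).1) (hsum₁.mul_left 2)
  · exact Summable.of_nonneg_of_le
      (fun j => mul_nonneg (Matrix.sigmaMin_nonneg _) (sq_nonneg _))
      (fun j => Matrix.sigmaMin_mul_sinTheta_le hkn₂ (hst j).2) (hsum₂.mul_left 2)
  · exact Summable.of_nonneg_of_le
      (fun j => mul_nonneg (Matrix.sigmaMin_nonneg _) (by positivity))
      (fun j => Matrix.sigmaMin_mul_ratio_le hkn₁ (hst j).1) (hsum₁.mul_left 2)
  · exact Summable.of_nonneg_of_le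
      (fun j => mul_nonneg (Matrix.sigmaMin_nonneg _) (by positivity))
      (fun j => Matrix.sigmaMin_mul_ratio_le hkn₂ (hst j).2) (hsum₂.mul_left 2)
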